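/- A permutation $\pi$ of $\{1,\dots,N\}$ is called alternating (up-down) if $\pi(1)<\pi(2)>\pi(3)<\pi(4)>\cdots$. It avoids a permutation $\sigma$ of $\{1,\dots,k\}$ if there are no indices $i_1<i_2<\cdots<i_k$ such that $\pi(i_1)\pi(i_2)\cdots\pi(i_k)$ is order-isomorphic to $\sigma$. For $n\ge 0$ let $r_n$ be the number of alternating permutations of $\{1,\dots,2n+1\}$ that avoid both $2413$ and $3142$, and let $R(x)=\sum_{n=1}^{\infty} r_n x^n$, a formal power series. Then $$R(x)=x\,(R(x)+1)^2+x\,(R(x)+1)^3.$$ Consequently, $r_0=1$ and, for all $n\ge 1$, $$r_n=\frac{2}{n}\sum_{i=0}^{n-1}2^{i}\binom{2n}{i}\binom{n}{i+1}.$$ -/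

import Mathlib

namespace PermPattern

/-- The permutation `π` of length `n` contains the pattern `σ` of length `k`: there are
positions `f 0 < f 1 < ⋯ < f (k - 1)` at which the values of `π` are order-isomorphic to `σ`. -/
def Contains {n k : ℕ} (π : Equiv.Perm (Fin n)) (σ : Equiv.Perm (Fin k)) : Prop :=
  ∃ f : Fin k → Fin n, StrictMono f ∧ ∀ i j : Fin k, π (f i) < π (f j) ↔ σ i < σ j

/-- `π` avoids the pattern `σ`. -/
def Avoids {n k : ℕ} (π : Equiv.Perm (Fin n)) (σ : Equiv.Perm (Fin k)) : Prop :=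
  ¬ Contains π σ

/-- `π` is alternating (up-down): `π(1) < π(2) > π(3) < ⋯`. Positions are counted from `0` here,
so there is an ascent at every even position and a descent at every odd position. -/
def IsAlternating {n : ℕ} (π : Equiv.Perm (Fin n)) : Prop :=
  ∀ i j : Fin n, (i : ℕ) + 1 = (j : ℕ) →
    (Even (i : ℕ) → π i < π j) ∧ (Odd (i : ℕ) → π j < π i)

/-- The pattern `2413`, with positions and values counted from `0`. -/
def p2413 : Equiv.Perm (Fin 4) where
  toFun := ![1, 3, 0, 2]
  invFun := ![2, 0, 3, 1]
  left_inv := by decide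
  right_inv := by decide

/-- The pattern `3142`, with positions and values counted from `0`. -/
def p3142 : Equiv.Perm (Fin 4) where
  toFun := ![2, 0, 3, 1]
  invFun := ![1, 3, 0, 2]
  left_inv := by decide
  right_inv := by decide

/-- The set of alternating permutations of length `n` that avoid both `σ` and `τ`. -/
def altAvoiding (n : ℕ) {k l : ℕ} (σ : Equiv.Perm (Fin k)) (τ : Equiv.Perm (Fin l)) :
    Set (Equiv.Perm (Fin n)) :=
  {π | IsAlternating π ∧ Avoids π σ ∧ Avoids π τ}

/-- `r n` is the number of alternating permutations of length `2 * n + 1` that avoid both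
`2413` and `3142`. -/
noncomputable def r (n : ℕ) : ℕ := (altAvoiding (2 * n + 1) p2413 p3142).ncard

/-- The generating function `R(x) = ∑_{n ≥ 1} r n * x ^ n`, a formal power series over `ℚ`
(the sum starts at `n = 1`, so the constant coefficient is `0`). -/
noncomputable def R : PowerSeries ℚ :=
  PowerSeries.mk fun n => if n = 0 then 0 else (r n : ℚ)

end PermPattern

/-! The permutations counted are the separable ones, and a separable permutation of length at least
2 is either a direct sum or a skew sum, never both (`exists_cut_or_cocut`,
`IsSeparable.isIndec_compl_iff`). Complementation exchanges the two kinds and shifts the parity `e`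
of the ascent positions, so only direct sums need counting. Splitting off the shortest first summand
of a direct sum gives an indecomposable part and an arbitrary one. The junction is an ascent, so `e`
fixes the parity of the first length (`card_altDec`). With F = R + 1, E the series of positive even
lengths, and a, b (odd length) and c, d (even length) the series of direct sums for e = 0, 1, this
reads F = 1 + a + b, E = c + d, a = (1 + b)E, b = cF, d = cE, c = x(1 + b)F. Elimination gives a = b
and F - 1 = xF²(1 + F); Lagrange inversion then yields the coefficients. -/

/-! ### Lagrange inversion and the coefficient formula -/

section LagrangeInversion
open PowerSeries

/-- The residue of `(X * g)' / (X * g) ^ (m + 2)` vanishes, where `h = g⁻¹`. -/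
theorem PowerSeries.coeff_derivative_mul_pow_inv {g h : PowerSeries ℚ} (hgh : g * h = 1) (m : ℕ) :
    coeff (m + 1) (derivative ℚ (X * g) * h ^ (m + 2)) = 0 := by
  have hder : derivative ℚ h = - (derivative ℚ g) * h ^ 2 := by
    have h1 := congrArg (derivative ℚ) hgh
    rw [Derivation.leibniz, smul_eq_mul, smul_eq_mul, derivative_one] at h1
    linear_combination h * h1 - derivative ℚ h * hgh
  -- The operator X · d/dX multiplies the coefficient of degree m + 1 by m + 1, so the right side
  -- has none in that degree.
  have key : ((m + 1 : ℕ) : PowerSeries ℚ) * (derivative ℚ (X * g) * h ^ (m + 2)) =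
      ((m + 1 : ℕ) : PowerSeries ℚ) * h ^ (m + 1) - X * derivative ℚ (h ^ (m + 1)) := by
    rw [derivative_pow, Nat.add_sub_cancel, hder, Derivation.leibniz, smul_eq_mul, smul_eq_mul,
      derivative_X]
    linear_combination ((m + 1 : ℕ) : PowerSeries ℚ) * h ^ (m + 1) * hgh
  have h2 := congrArg (coeff (m + 1)) key
  rw [map_sub, coeff_succ_X_mul, coeff_derivative, ← map_natCast (C (R := ℚ)), coeff_C_mul,
    coeff_C_mul] at h2
  have h3 : ((m + 1 : ℕ) : ℚ) ≠ 0 := by positivity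
  refine (mul_eq_zero.mp (h2.trans ?_)).resolve_left h3
  push_cast
  ring

/-- Lagrange inversion for a polynomial `φ`. -/
theorem PowerSeries.natCast_mul_coeff_of_eq_X_mul_aeval {φ : Polynomial ℚ} {A : PowerSeries ℚ}
    (hA : A = X * Polynomial.aeval A φ) (hφ : φ.coeff 0 ≠ 0) (n : ℕ) :
    ((n + 1 : ℕ) : ℚ) * coeff (n + 1) A = (φ ^ (n + 1)).coeff n := by
  obtain ⟨g, hg⟩ : ∃ g, Polynomial.aeval A φ = g := ⟨_, rfl⟩
  rw [hg] at hA
  have hA0 : constantCoeff A = 0 := by rw [hA]; simp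
  have hg0 : constantCoeff g ≠ 0 := by
    rw [← hg, Polynomial.aeval_def, Polynomial.hom_eval₂, hA0, Polynomial.eval₂_at_zero]
    simpa using hφ
  have hgh : g * g⁻¹ = 1 := PowerSeries.mul_inv_cancel g hg0
  set h := g⁻¹
  -- Since h = X / A, this is the residue of A' A^(k-n-1), nonzero only for the logarithmic
  -- derivative, k = n.
  have hterm : ∀ k, coeff n (derivative ℚ A * (A ^ k * h ^ (n + 1))) = if k = n then 1 else 0 := by
    intro k
    rcases Nat.lt_or_ge n k with hk | hk
    · rw [if_neg hk.ne']
      nth_rewrite 2 [hA]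
      rw [mul_pow, mul_assoc, mul_left_comm, coeff_X_pow_mul', if_neg hk.not_ge]
    · obtain ⟨m, rfl⟩ := Nat.exists_eq_add_of_le hk
      have h1 : derivative ℚ A * (A ^ k * h ^ (k + m + 1)) =
          X ^ k * (derivative ℚ (X * g) * h ^ (m + 1)) := by
        rw [← hA]
        nth_rewrite 2 [hA]
        calc _ = X ^ k * (derivative ℚ A * h ^ (m + 1)) * (g * h) ^ k := by ring
          _ = _ := by rw [hgh, one_pow, mul_one]
      rw [h1, add_comm k m, coeff_X_pow_mul]
      rcases m with _ | m
      · rw [Derivation.leibniz, smul_eq_mul, smul_eq_mul, derivative_X, mul_one, zero_add,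
          pow_one, add_mul, hgh, mul_assoc, map_add]
        simp
      · rw [coeff_derivative_mul_pow_inv hgh m, if_neg (by omega)]
  have hexp : derivative ℚ A =
      derivative ℚ A * (Polynomial.aeval A (φ ^ (n + 1)) * h ^ (n + 1)) := by
    rw [map_pow, hg, ← mul_pow, hgh, one_pow, mul_one]
  have h1 : coeff n (derivative ℚ A) = (φ ^ (n + 1)).coeff n := by
    rw [hexp, Polynomial.aeval_eq_sum_range, Finset.sum_mul, Finset.mul_sum, map_sum]
    simp only [smul_mul_assoc, mul_smul_comm, map_smul, hterm, smul_eq_mul, mul_ite, mul_one,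
      mul_zero, Finset.sum_ite_eq', Finset.mem_range]
    split_ifs with h
    · rfl
    · exact (Polynomial.coeff_eq_zero_of_natDegree_lt (by omega)).symm
  rw [← h1, coeff_derivative, mul_comm]
  push_cast
  rfl

/-- The coefficients of the solution of `A = X (A + 1)² + X (A + 1)³`. -/
theorem coeff_of_eq_X_mul_sq_add_X_mul_cube {A : PowerSeries ℚ}
    (hA : A = X * (A + 1) ^ 2 + X * (A + 1) ^ 3) {n : ℕ} (hn : 1 ≤ n) :
    coeff n A = (2 / (n : ℚ)) * ∑ i ∈ Finset.range n,
      (2 : ℚ) ^ i * ((2 * n).choose i : ℚ) * (n.choose (i + 1) : ℚ) := by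
  obtain ⟨n, rfl⟩ := Nat.exists_eq_add_of_le' hn
  have key := PowerSeries.natCast_mul_coeff_of_eq_X_mul_aeval (A := A)
    (φ := (1 + Polynomial.X) ^ 2 * (Polynomial.X + Polynomial.C 2))
    (by
      simp only [map_mul, map_pow, map_add, map_one, Polynomial.aeval_X,
        map_ofNat]
      linear_combination hA)
    (by simp [Polynomial.coeff_zero_eq_eval_zero]) n
  have hcoeff : (((1 + Polynomial.X) ^ 2 * (Polynomial.X + Polynomial.C 2)) ^ (n + 1) :
      Polynomial ℚ).coeff n = 2 * ∑ i ∈ Finset.range (n + 1),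
      (2 : ℚ) ^ i * ((2 * (n + 1)).choose i : ℚ) * ((n + 1).choose (i + 1) : ℚ) := by
    rw [mul_pow, ← pow_mul, Polynomial.coeff_mul,
      Finset.Nat.sum_antidiagonal_eq_sum_range_succ_mk, Finset.mul_sum]
    refine Finset.sum_congr rfl fun i hi => ?_
    have hi : i ≤ n := Nat.lt_succ_iff.mp (Finset.mem_range.mp hi)
    -- The second factor contributes 2^(i+1); one 2 becomes the prefactor of the sum.
    rw [Polynomial.coeff_one_add_X_pow, Polynomial.coeff_X_add_C_pow,
      ← Nat.choose_symm (show n - i ≤ n + 1 by omega), show n + 1 - (n - i) = i + 1 by omega]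
    ring
  have hne : ((n + 1 : ℕ) : ℚ) ≠ 0 := by positivity
  rw [hcoeff] at key
  field_simp
  linear_combination key

end LagrangeInversion

/-! ### Separable sequences split as direct or skew sums -/

namespace PermPattern

/-- A sequence of integers avoiding `2413` and `3142` on `[0, m)`, `m ≥ 2`, splits into a direct or
a skew sum. -/
theorem exists_cut_or_cocut (f : ℕ → ℤ) (m : ℕ) (hm : 2 ≤ m)
    (hinj : ∀ i j, i < j → j < m → f i ≠ f j)
    (h1 : ∀ a b c d, a < b → b < c → c < d → d < m → ¬ (f c < f a ∧ f a < f d ∧ f d < f b))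
    (h2 : ∀ a b c d, a < b → b < c → c < d → d < m → ¬ (f b < f d ∧ f d < f a ∧ f a < f c)) :
    ∃ k, 0 < k ∧ k < m ∧ ((∀ i j, i < k → k ≤ j → j < m → f i < f j) ∨
      (∀ i j, i < k → k ≤ j → j < m → f j < f i)) := by
  -- Induction step: append one entry to a direct sum cut at k. If its value lies strictly inside
  -- the range of the first block, the cut moves to the first entry t exceeding it.
  have extend : ∀ (g : ℕ → ℤ) (m k : ℕ), 0 < k → k < m →
      (∀ i j, i < j → j < m + 1 → g i ≠ g j) →
      (∀ a b c d, a < b → b < c → c < d → d < m + 1 → ¬ (g b < g d ∧ g d < g a ∧ g a < g c)) →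
      (∀ i j, i < k → k ≤ j → j < m → g i < g j) →
      ∃ k, 0 < k ∧ k < m + 1 ∧ ((∀ i j, i < k → k ≤ j → j < m + 1 → g i < g j) ∨
        (∀ i j, i < k → k ≤ j → j < m + 1 → g j < g i)) := by
    intro g m k hk hkm hg hav hcut
    by_cases hall : ∀ i, i < k → g i < g m
    · refine ⟨k, hk, by omega, Or.inl fun i j hi hj hjm => ?_⟩
      rcases Nat.lt_succ_iff_lt_or_eq.mp hjm with h | rfl
      · exact hcut i j hi hj h
      · exact hall i hi
    by_cases hnone : ∀ i, i < k → g m < g i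
    · refine ⟨m, by omega, by omega, Or.inr fun i j hi hj hjm => ?_⟩
      obtain rfl : j = m := by omega
      by_cases hik : i < k
      · exact hnone i hik
      · exact (hnone 0 hk).trans (hcut 0 i hk (by omega) hi)
    push Not at hall hnone
    classical
    have hex : ∃ i, i < k ∧ g m ≤ g i := hall
    obtain ⟨hlk, hl⟩ := Nat.find_spec hex
    have hmin : ∀ i, i < Nat.find hex → g i < g m := fun i hi => by
      have := Nat.find_min hex hi
      push Not at this
      exact this (hi.trans hlk)
    set t := Nat.find hex
    have htm : g m < g t := lt_of_le_of_ne hl (hg t m (by omega) (by omega)).symm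
    have hhigh : ∀ j, t ≤ j → j < k → g m < g j := fun j hj hjk => by
      rcases hj.eq_or_lt with rfl | hj
      · exact htm
      · by_contra hlt
        have hne := hg j m (by omega) (by omega)
        -- An entry j of the first block after t and below the new value would make t, j, k, m a
        -- 3142.
        exact hav t j k m hj hjk hkm (by omega)
          ⟨lt_of_le_of_ne (not_lt.mp hlt) hne, htm, hcut t k hlk le_rfl hkm⟩
    obtain ⟨a, hak, ha⟩ := hnone
    have ht0 : 0 < t := by
      rcases Nat.eq_zero_or_pos t with h | h
      · exact absurd (hhigh a (by omega) hak) (not_lt.mpr ha)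
      · exact h
    refine ⟨t, ht0, by omega, Or.inl fun i j hi hj hjm => ?_⟩
    have hi' := hmin i hi
    rcases Nat.lt_succ_iff_lt_or_eq.mp hjm with h | rfl
    · by_cases hjk : j < k
      · exact hi'.trans (hhigh j hj hjk)
      · exact hcut i j (by omega) (by omega) h
    · exact hi'
  induction m, hm using Nat.le_induction with
  | base =>
    refine ⟨1, by omega, by omega, ?_⟩
    rcases lt_or_gt_of_ne (hinj 0 1 (by omega) (by omega)) with h | h
    · refine Or.inl fun i j hi hj hjm => ?_
      obtain rfl : i = 0 := by omega
      obtain rfl : j = 1 := by omega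
      exact h
    · refine Or.inr fun i j hi hj hjm => ?_
      obtain rfl : i = 0 := by omega
      obtain rfl : j = 1 := by omega
      exact h
  | succ m hm ih =>
    obtain ⟨k, hk, hkm, hcut | hcut⟩ := ih (fun i j hi hj => hinj i j hi (by omega))
      (fun a b c d ha hb hc hd => h1 a b c d ha hb hc (by omega))
      (fun a b c d ha hb hc hd => h2 a b c d ha hb hc (by omega))
    · exact extend f m k hk hkm hinj h2 hcut
    -- Negation turns skew cuts into direct cuts and 2413 into 3142.
    · obtain ⟨k, hk, hkm, h⟩ := extend (fun i => - f i) m k hk hkm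
        (fun i j hi hj h => hinj i j hi hj (neg_injective h))
        (fun a b c d ha hb hc hd ⟨x, y, z⟩ => h1 a b c d ha hb hc hd
          ⟨neg_lt_neg_iff.mp z, neg_lt_neg_iff.mp y, neg_lt_neg_iff.mp x⟩)
        (fun i j hi hj hjm => neg_lt_neg (hcut i j hi hj hjm))
      refine ⟨k, hk, hkm, h.symm.imp ?_ ?_⟩ <;>
        exact fun h i j hi hj hjm => neg_lt_neg_iff.mp (h i j hi hj hjm)

/-! ### Separability, alternation and complement -/

/-- No four positions of `π` carry the pattern `2413` or `3142`. -/
def IsSeparable {n : ℕ} (π : Equiv.Perm (Fin n)) : Prop :=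
  ∀ a b c d : Fin n, a < b → b < c → c < d →
    ¬ (π c < π a ∧ π a < π d ∧ π d < π b) ∧ ¬ (π b < π d ∧ π d < π a ∧ π a < π c)

/-- The ascents of `π` are exactly the positions `i` with `i + e` even. -/
def IsAltFrom {n : ℕ} (e : ℕ) (π : Equiv.Perm (Fin n)) : Prop :=
  ∀ i j : Fin n, (i : ℕ) + 1 = j → (π i < π j ↔ Even ((i : ℕ) + e))

/-- `π` is a direct sum of two permutations, the first one of length `k`. -/
def IsCut {n : ℕ} (π : Equiv.Perm (Fin n)) (k : ℕ) : Prop :=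
  ∀ i j : Fin n, (i : ℕ) < k → k ≤ (j : ℕ) → π i < π j

/-- `π` is not a direct sum of two nonempty permutations. -/
def IsIndec {n : ℕ} (π : Equiv.Perm (Fin n)) : Prop :=
  ∀ k, 0 < k → k < n → ¬ IsCut π k

theorem avoids_iff {n : ℕ} (π : Equiv.Perm (Fin n)) (σ : Equiv.Perm (Fin 4)) :
    Avoids π σ ↔ ∀ a b c d : Fin n, a < b → b < c → c < d →
      ¬ ∀ i j : Fin 4, π (![a, b, c, d] i) < π (![a, b, c, d] j) ↔ σ i < σ j := by
  unfold Avoids Contains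
  constructor
  · intro h a b c d hab hbc hcd H
    refine h ⟨![a, b, c, d], ?_, H⟩
    rw [Fin.strictMono_iff_lt_succ]
    intro i
    fin_cases i
    · exact hab
    · exact hbc
    · exact hcd
  · rintro h ⟨f, hf, H⟩
    refine h (f 0) (f 1) (f 2) (f 3) (hf (by decide)) (hf (by decide)) (hf (by decide)) ?_
    have : ![f 0, f 1, f 2, f 3] = f := by
      ext i; fin_cases i <;> rfl
    rw [this]
    exact H

theorem isSeparable_iff {n : ℕ} (π : Equiv.Perm (Fin n)) :
    IsSeparable π ↔ Avoids π p2413 ∧ Avoids π p3142 := by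
  rw [avoids_iff, avoids_iff]
  simp only [Fin.forall_fin_succ, IsSeparable, p2413, p3142, Equiv.coe_fn_mk]
  constructor
  · intro h
    refine ⟨fun a b c d h1 h2 h3 H => (h a b c d h1 h2 h3).1 ?_,
      fun a b c d h1 h2 h3 H => (h a b c d h1 h2 h3).2 ?_⟩
    · simp at H; grind
    · simp at H; grind
  · rintro ⟨h, h'⟩ a b c d h1 h2 h3
    refine ⟨fun H => h a b c d h1 h2 h3 ?_, fun H => h' a b c d h1 h2 h3 ?_⟩
    · simp; grind
    · simp; grind

theorem mem_altAvoiding_iff {n : ℕ} (π : Equiv.Perm (Fin n)) :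
    π ∈ altAvoiding n p2413 p3142 ↔ IsSeparable π ∧ IsAltFrom 0 π := by
  rw [altAvoiding, Set.mem_ofPred_eq, ← isSeparable_iff, and_comm]
  refine and_congr_right fun _ => forall_congr' fun i => forall_congr' fun j =>
    forall_congr' fun hij => ?_
  have hne : π i ≠ π j := fun h => by
    have := congrArg Fin.val (π.injective h)
    omega
  rw [add_zero, ← Nat.not_even_iff_odd]
  constructor
  · rintro ⟨h1, h2⟩
    exact ⟨fun h => by_contra fun he => (h2 he).not_gt h, h1⟩
  · exact fun h => ⟨h.2, fun he => lt_of_le_of_ne (not_lt.mp fun h' => he (h.1 h')) hne.symm⟩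


/-- The complement of a permutation. -/
def compl {n : ℕ} (π : Equiv.Perm (Fin n)) : Equiv.Perm (Fin n) := π.trans Fin.revPerm

theorem compl_lt_compl {n : ℕ} (π : Equiv.Perm (Fin n)) (i j : Fin n) :
    compl π i < compl π j ↔ π j < π i := by
  simp [compl]

theorem compl_compl {n : ℕ} (π : Equiv.Perm (Fin n)) : compl (compl π) = π := by
  ext i; simp [compl]

theorem IsSeparable.compl {n : ℕ} {π : Equiv.Perm (Fin n)} (h : IsSeparable π) :
    IsSeparable (compl π) := by
  intro a b c d h1 h2 h3
  simp only [compl_lt_compl]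
  have := h a b c d h1 h2 h3
  tauto

theorem IsAltFrom.compl {n e : ℕ} {π : Equiv.Perm (Fin n)} (h : IsAltFrom e π) :
    IsAltFrom (e + 1) (compl π) := by
  intro i j hij
  have hne : π i ≠ π j := fun h => by
    have := congrArg Fin.val (π.injective h)
    omega
  rw [compl_lt_compl, ← add_assoc, Nat.even_add_one, ← h i j hij, not_lt]
  exact ⟨le_of_lt, fun h => lt_of_le_of_ne h hne.symm⟩

theorem isAltFrom_add_two {n e : ℕ} (π : Equiv.Perm (Fin n)) :
    IsAltFrom (e + 2) π ↔ IsAltFrom e π := by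
  simp [IsAltFrom, ← add_assoc, Nat.even_add]

theorem not_isIndec_iff {n : ℕ} (π : Equiv.Perm (Fin n)) :
    ¬ IsIndec π ↔ ∃ k, 0 < k ∧ k < n ∧ IsCut π k := by
  simp [IsIndec]

/-- Direct and skew cuts order the first and last entries oppositely, so they exclude each other;
`exists_cut_or_cocut` supplies one of them. -/
theorem IsSeparable.isIndec_compl_iff {n : ℕ} (hn : 2 ≤ n) {π : Equiv.Perm (Fin n)}
    (h : IsSeparable π) : IsIndec (PermPattern.compl π) ↔ ¬ IsIndec π := by
  rw [← not_iff_not, not_not, not_isIndec_iff]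
  constructor
  · rintro ⟨k, hk, hkn, hc⟩ k' hk' hkn' hc'
    have h1 := hc ⟨0, by omega⟩ ⟨n - 1, by omega⟩ hk (by simp; omega)
    rw [compl_lt_compl] at h1
    exact (hc' ⟨0, by omega⟩ ⟨n - 1, by omega⟩ hk' (by simp; omega)).not_gt h1
  · intro hI
    let f : ℕ → ℤ := fun i => if hi : i < n then ((π ⟨i, hi⟩ : ℕ) : ℤ) else 0
    have hf : ∀ i : Fin n, f i = ((π i : ℕ) : ℤ) := fun i => by simp [f]
    have hflt : ∀ i j : Fin n, f i < f j ↔ π i < π j := fun i j => by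
      rw [hf, hf, Nat.cast_lt, Fin.lt_def]
    have hinj : ∀ i j, i < j → j < n → f i ≠ f j := by
      intro i j hij hj he
      have he' : f (⟨i, hij.trans hj⟩ : Fin n) = f (⟨j, hj⟩ : Fin n) := he
      rw [hf, hf, Nat.cast_inj, Fin.val_inj, π.injective.eq_iff, Fin.mk.injEq] at he'
      exact hij.ne he'
    have hsep : ∀ a b c d, a < b → b < c → c < d → d < n →
        ¬ (f c < f a ∧ f a < f d ∧ f d < f b) ∧ ¬ (f b < f d ∧ f d < f a ∧ f a < f c) := by
      intro a b c d hab hbc hcd hd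
      have := h ⟨a, by omega⟩ ⟨b, by omega⟩ ⟨c, by omega⟩ ⟨d, hd⟩ hab hbc hcd
      simpa only [← hflt] using this
    obtain ⟨k, hk, hkn, hc | hc⟩ := exists_cut_or_cocut f n hn hinj
      (fun a b c d h1 h2 h3 h4 => (hsep a b c d h1 h2 h3 h4).1)
      (fun a b c d h1 h2 h3 h4 => (hsep a b c d h1 h2 h3 h4).2)
    · exact absurd (fun i j hi hj => (hflt i j).mp (hc i j hi hj j.2)) (hI k hk hkn)
    · exact ⟨k, hk, hkn, fun i j hi hj =>
        (compl_lt_compl π i j).mpr ((hflt j i).mp (hc i j hi hj j.2))⟩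

/-! ### Direct sums -/

/-- The direct sum of two permutations. -/
def directSum {k l : ℕ} (α : Equiv.Perm (Fin k)) (β : Equiv.Perm (Fin l)) :
    Equiv.Perm (Fin (k + l)) :=
  finSumFinEquiv.permCongr (Equiv.sumCongr α β)

theorem castAdd_lt_castAdd {k l : ℕ} (i j : Fin k) :
    Fin.castAdd l i < Fin.castAdd l j ↔ i < j := Iff.rfl

theorem castAdd_lt_natAdd {k l : ℕ} (i : Fin k) (j : Fin l) :
    Fin.castAdd l i < Fin.natAdd k j := by
  rw [Fin.lt_def, Fin.val_castAdd, Fin.val_natAdd]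
  omega

section directSum
variable {k l : ℕ} (α : Equiv.Perm (Fin k)) (β : Equiv.Perm (Fin l))

@[simp] theorem directSum_castAdd (i : Fin k) :
    directSum α β (Fin.castAdd l i) = Fin.castAdd l (α i) := by
  simp [directSum]

@[simp] theorem directSum_natAdd (j : Fin l) :
    directSum α β (Fin.natAdd k j) = Fin.natAdd k (β j) := by
  simp [directSum]

theorem directSum_injective :
    Function.Injective fun p : Equiv.Perm (Fin k) × Equiv.Perm (Fin l) => directSum p.1 p.2 := by
  rintro ⟨α, β⟩ ⟨α', β'⟩ h
  have h : directSum α β = directSum α' β' := h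
  refine Prod.ext (Equiv.ext fun i => ?_) (Equiv.ext fun j => ?_)
  · simpa using Equiv.congr_fun h (Fin.castAdd l i)
  · simpa using Equiv.congr_fun h (Fin.natAdd k j)

theorem isCut_directSum : IsCut (directSum α β) k := by
  intro i j hi hj
  induction i using Fin.addCases with
  | right i => simp at hi
  | left i =>
    induction j using Fin.addCases with
    | left j => simp at hj; omega
    | right j =>
      rw [directSum_castAdd, directSum_natAdd]
      exact castAdd_lt_natAdd _ _

theorem isCut_directSum_iff {k' : ℕ} (hk : k' < k) :
    IsCut (directSum α β) k' ↔ IsCut α k' := by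
  constructor
  · intro h i j hi hj
    simpa [castAdd_lt_castAdd] using h (Fin.castAdd l i) (Fin.castAdd l j) hi hj
  · intro h i j hi hj
    induction i using Fin.addCases with
    | right i => simp at hi; omega
    | left i =>
      induction j using Fin.addCases with
      | left j => simpa [castAdd_lt_castAdd] using h i j hi hj
      | right j => exact isCut_directSum α β _ _ i.2 (by simp)

theorem isSeparable_directSum_iff :
    IsSeparable (directSum α β) ↔ IsSeparable α ∧ IsSeparable β := by
  constructor
  · intro h
    refine ⟨fun a b c d h1 h2 h3 => ?_, fun a b c d h1 h2 h3 => ?_⟩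
    · simpa [castAdd_lt_castAdd] using
        h (Fin.castAdd l a) (Fin.castAdd l b) (Fin.castAdd l c) (Fin.castAdd l d) h1 h2 h3
    · simpa [castAdd_lt_castAdd] using
        h (Fin.natAdd k a) (Fin.natAdd k b) (Fin.natAdd k c) (Fin.natAdd k d)
          (by simpa using h1) (by simpa using h2) (by simpa using h3)
  · rintro ⟨h, h'⟩ a b c d h1 h2 h3
    induction a using Fin.addCases <;> induction b using Fin.addCases <;>
      induction c using Fin.addCases <;> induction d using Fin.addCases <;>
      simp_all [castAdd_lt_castAdd, castAdd_lt_natAdd, (castAdd_lt_natAdd _ _).not_gt]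
    · simpa using h _ _ _ _ h1 h2 h3
    · simpa using h' _ _ _ _ h1 h2 h3

/-- The step from position k - 1 to k is always an ascent, which forces k - 1 + e to be even;
positions of `β` are shifted by k. -/
theorem isAltFrom_directSum_iff (hk : 0 < k) (hl : 0 < l) (e : ℕ) :
    IsAltFrom e (directSum α β) ↔ Odd (k + e) ∧ IsAltFrom e α ∧ IsAltFrom (k + e) β := by
  constructor
  · intro h
    refine ⟨?_, fun i j hij => ?_, fun i j hij => ?_⟩
    · have := (h ⟨k - 1, by omega⟩ ⟨k, by omega⟩ (by simp; omega)).mp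
        (isCut_directSum α β _ _ (by simp; omega) (by simp))
      simp only at this
      rw [show k + e = (k - 1 + e) + 1 by omega]
      exact this.add_one
    · simpa [castAdd_lt_castAdd] using h (Fin.castAdd l i) (Fin.castAdd l j) hij
    · have := h (Fin.natAdd k i) (Fin.natAdd k j) (by simp; omega)
      simp only [directSum_natAdd, Fin.natAdd_lt_natAdd_iff, Fin.val_natAdd] at this
      rw [this, add_left_comm, add_assoc]
  · rintro ⟨hodd, hα, hβ⟩ i j hij
    induction i using Fin.addCases with
    | right i =>
      induction j using Fin.addCases with
      | left j => simp at hij; omega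
      | right j =>
        have := hβ i j (by simp at hij; omega)
        simp only [directSum_natAdd, Fin.natAdd_lt_natAdd_iff, Fin.val_natAdd]
        rw [this, add_left_comm, add_assoc]
    | left i =>
      induction j using Fin.addCases with
      | left j => simpa [castAdd_lt_castAdd] using hα i j hij
      | right j =>
        refine iff_of_true (isCut_directSum α β _ _ i.2 (by simp)) ?_
        simp only [Fin.val_castAdd, Fin.val_natAdd] at hij ⊢
        have : (i : ℕ) + e + 1 = k + e := by omega
        rw [← this, Nat.odd_add_one, Nat.not_odd_iff_even] at hodd
        exact hodd

end directSum

theorem IsCut.exists_directSum {k l : ℕ} {π : Equiv.Perm (Fin (k + l))} (h : IsCut π k) :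
    ∃ α β, directSum α β = π := by
  have hlt : ∀ i : Fin (k + l), (i : ℕ) < k → (π i : ℕ) < k := by
    intro i hi
    -- The l values at later positions all exceed `π i`, which leaves `π i` below k.
    have hsub : (Finset.univ.map (Fin.natAddEmb k : Fin l ↪ Fin (k + l))).map π.toEmbedding ⊆
        Finset.Ioi (π i) := by
      intro x hx
      simp only [Finset.mem_map, Finset.mem_univ, true_and] at hx
      obtain ⟨_, ⟨j, rfl⟩, rfl⟩ := hx
      exact Finset.mem_Ioi.mpr (h _ _ hi (by simp))
    have := Finset.card_le_card hsub
    simp at this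
    omega
  obtain ⟨⟨α, β⟩, hp⟩ := Equiv.Perm.mem_sumCongrHom_range_of_perm_mapsTo_inl
    (σ := finSumFinEquiv.symm.permCongr π) (by
      rintro _ ⟨i, rfl⟩
      have := hlt (Fin.castAdd l i) i.2
      refine ⟨⟨_, this⟩, ?_⟩
      rw [Equiv.permCongr_apply, Equiv.symm_symm, finSumFinEquiv_apply_left,
        Equiv.eq_symm_apply, finSumFinEquiv_apply_left]
      rfl)
  refine ⟨α, β, ?_⟩
  have hp : Equiv.sumCongr α β = finSumFinEquiv.symm.permCongr π := hp
  rw [directSum, hp]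
  ext; simp


/-! ### Counting by the first indecomposable summand -/

open Classical in
/-- The separable permutations of length `n` whose ascents are at the positions `i` with `i + e`
even. -/
noncomputable def altSep (n e : ℕ) : Finset (Equiv.Perm (Fin n)) :=
  {π | IsSeparable π ∧ IsAltFrom e π}

open Classical in
/-- The members of `altSep n e` that are not direct sums. -/
noncomputable def altIndec (n e : ℕ) : Finset (Equiv.Perm (Fin n)) :=
  {π ∈ altSep n e | IsIndec π}

open Classical in
/-- The members of `altSep n e` that are direct sums. -/
noncomputable def altDec (n e : ℕ) : Finset (Equiv.Perm (Fin n)) :=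
  {π ∈ altSep n e | ¬ IsIndec π}

theorem mem_altSep {n e : ℕ} {π : Equiv.Perm (Fin n)} :
    π ∈ altSep n e ↔ IsSeparable π ∧ IsAltFrom e π := by
  simp [altSep]

theorem mem_altIndec {n e : ℕ} {π : Equiv.Perm (Fin n)} :
    π ∈ altIndec n e ↔ π ∈ altSep n e ∧ IsIndec π := by
  simp [altIndec]

theorem mem_altDec {n e : ℕ} {π : Equiv.Perm (Fin n)} :
    π ∈ altDec n e ↔ π ∈ altSep n e ∧ ¬ IsIndec π := by
  simp [altDec]

theorem card_altIndec_add_card_altDec (n e : ℕ) :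
    (altIndec n e).card + (altDec n e).card = (altSep n e).card :=
  by classical exact Finset.card_filter_add_card_filter_not _

theorem altSep_add_two (n e : ℕ) : altSep n (e + 2) = altSep n e := by
  ext π; simp [mem_altSep, isAltFrom_add_two]

theorem altDec_add_two (n e : ℕ) : altDec n (e + 2) = altDec n e := by
  ext π; simp [mem_altDec, altSep_add_two]

theorem compl_mem_altSep {n e : ℕ} {π : Equiv.Perm (Fin n)} (h : π ∈ altSep n e) :
    compl π ∈ altSep n (e + 1) := by
  rw [mem_altSep] at h ⊢
  exact ⟨h.1.compl, h.2.compl⟩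

theorem compl_mem_altSep' {n e : ℕ} {π : Equiv.Perm (Fin n)} (h : π ∈ altSep n (e + 1)) :
    compl π ∈ altSep n e := by
  rw [← altSep_add_two]
  exact compl_mem_altSep h

theorem card_altSep_add_one (n e : ℕ) : (altSep n (e + 1)).card = (altSep n e).card :=
  Finset.card_nbij' compl compl (fun _ h => compl_mem_altSep' h) (fun _ h => compl_mem_altSep h)
    (fun π _ => compl_compl π) (fun π _ => compl_compl π)

theorem card_altSep (n e : ℕ) : (altSep n e).card = (altSep n 0).card := by
  induction e with
  | zero => rfl
  | succ e ih => rw [card_altSep_add_one, ih]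

/-- Complementation is the bijection. It fails for n = 1, where the only permutation is
indecomposable; hence the constant 1 in the series identities. -/
theorem card_altIndec {n : ℕ} (hn : 2 ≤ n) (e : ℕ) :
    (altIndec n e).card = (altDec n (e + 1)).card := by
  refine Finset.card_nbij' compl compl (fun π h => ?_) (fun π h => ?_)
    (fun π _ => compl_compl π) (fun π _ => compl_compl π)
  · rw [Finset.mem_coe, mem_altIndec] at h
    rw [Finset.mem_coe, mem_altDec, (mem_altSep.mp h.1).1.isIndec_compl_iff hn, not_not]
    exact ⟨compl_mem_altSep h.1, h.2⟩
  · rw [Finset.mem_coe, mem_altDec] at h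
    rw [Finset.mem_coe, mem_altIndec, (mem_altSep.mp h.1).1.isIndec_compl_iff hn]
    exact ⟨compl_mem_altSep' h.1, h.2⟩

theorem altDec_of_lt_two {n : ℕ} (hn : n < 2) (e : ℕ) : altDec n e = ∅ := by
  ext π
  simp only [mem_altDec, Finset.notMem_empty, iff_false, not_and, not_not]
  intro _ k hk hkn
  omega

theorem card_altSep_one (e : ℕ) : (altSep 1 e).card = 1 := by
  have : altSep 1 e = Finset.univ := by
    ext π
    simp only [mem_altSep, Finset.mem_univ, iff_true]
    exact ⟨fun a b _ _ h => by omega, fun i j h => by omega⟩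
  rw [this]
  simp

theorem card_altIndec_one (e : ℕ) : (altIndec 1 e).card = 1 := by
  have := card_altIndec_add_card_altDec 1 e
  rw [altDec_of_lt_two (by omega), card_altSep_one] at this
  simpa using this

open Classical in
/-- The members of `altDec n e` whose first summand has length `k`. -/
noncomputable def altCut (n e k : ℕ) : Finset (Equiv.Perm (Fin n)) :=
  {π ∈ altSep n e | IsCut π k ∧ ∀ k', 0 < k' → k' < k → ¬ IsCut π k'}

theorem mem_altCut {n e k : ℕ} {π : Equiv.Perm (Fin n)} :
    π ∈ altCut n e k ↔ π ∈ altSep n e ∧ IsCut π k ∧ ∀ k', 0 < k' → k' < k → ¬ IsCut π k' := by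
  simp [altCut]

theorem directSum_mem_altCut_iff {k l : ℕ} (hk : 0 < k) (hl : 0 < l) (e : ℕ)
    (α : Equiv.Perm (Fin k)) (β : Equiv.Perm (Fin l)) :
    directSum α β ∈ altCut (k + l) e k ↔
      Odd (k + e) ∧ α ∈ altIndec k e ∧ β ∈ altSep l (k + e) := by
  have hI : (∀ k', 0 < k' → k' < k → ¬ IsCut (directSum α β) k') ↔ IsIndec α :=
    forall_congr' fun k' => forall_congr' fun _ => forall_congr' fun h => by
      rw [isCut_directSum_iff α β h]
  rw [mem_altCut, mem_altSep, mem_altIndec, mem_altSep, mem_altSep, isSeparable_directSum_iff,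
    isAltFrom_directSum_iff α β hk hl, hI, iff_true_intro (isCut_directSum α β)]
  tauto

theorem card_altCut {k l : ℕ} (hk : 0 < k) (hl : 0 < l) (e : ℕ) :
    (altCut (k + l) e k).card =
      if Odd (k + e) then (altIndec k e).card * (altSep l 0).card else 0 := by
  split_ifs with h
  · rw [← card_altSep l (k + e), ← Finset.card_product]
    refine (Finset.card_nbij (fun p => directSum p.1 p.2) (fun p hp => ?_)
      directSum_injective.injOn fun π hπ => ?_).symm
    · rw [Finset.mem_coe, Finset.mem_product] at hp
      exact (directSum_mem_altCut_iff hk hl e _ _).mpr ⟨h, hp⟩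
    · obtain ⟨α, β, rfl⟩ := (mem_altCut.mp hπ).2.1.exists_directSum
      have := (directSum_mem_altCut_iff hk hl e _ _).mp hπ
      exact ⟨(α, β), Finset.mem_coe.mpr (Finset.mem_product.mpr this.2), rfl⟩
  · rw [Finset.card_eq_zero, Finset.eq_empty_iff_forall_notMem]
    intro π hπ
    obtain ⟨α, β, rfl⟩ := (mem_altCut.mp hπ).2.1.exists_directSum
    exact h ((directSum_mem_altCut_iff hk hl e _ _).mp hπ).1

/-- Each direct sum has a unique smallest cut, and the classes by that cut are disjoint. -/
theorem card_altDec_eq_sum_altCut (n e : ℕ) :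
    (altDec n e).card = ∑ p ∈ Finset.HasAntidiagonal.antidiagonal n,
      if 0 < p.1 ∧ 0 < p.2 then (altCut n e p.1).card else 0 := by
  classical
  rw [← Finset.sum_filter, ← Finset.card_biUnion]
  · congr 1
    ext π
    simp only [Finset.mem_biUnion, Finset.mem_filter, Finset.HasAntidiagonal.mem_antidiagonal, mem_altCut,
      mem_altDec, not_isIndec_iff]
    constructor
    · rintro ⟨hπ, hex⟩
      obtain ⟨h1, h2, h3⟩ := Nat.find_spec hex
      refine ⟨(Nat.find hex, n - Nat.find hex), ⟨?_, h1, ?_⟩, hπ, h3, fun k' hk' hlt hc => ?_⟩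
      · exact Nat.add_sub_of_le h2.le
      · exact Nat.sub_pos_of_lt h2
      · exact Nat.find_min hex hlt ⟨hk', hlt.trans h2, hc⟩
    · rintro ⟨p, ⟨hp, h1, h2⟩, hπ, hc, -⟩
      exact ⟨hπ, p.1, h1, by omega, hc⟩
  · intro p hp q hq hpq
    refine Finset.disjoint_left.mpr fun π hπ hπ' => hpq ?_
    simp only [Finset.mem_coe, Finset.mem_filter, Finset.HasAntidiagonal.mem_antidiagonal] at hp hq
    rw [mem_altCut] at hπ hπ'
    have h1 : ¬ p.1 < q.1 := fun h => hπ'.2.2 _ hp.2.1 h hπ.2.1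
    have h2 : ¬ q.1 < p.1 := fun h => hπ.2.2 _ hq.2.1 h hπ'.2.1
    ext <;> omega

theorem card_altDec (n e : ℕ) :
    (altDec n e).card = ∑ p ∈ Finset.HasAntidiagonal.antidiagonal n,
      if Odd (p.1 + e) ∧ 0 < p.1 ∧ 0 < p.2 then
        (altIndec p.1 e).card * (altSep p.2 0).card else 0 := by
  rw [card_altDec_eq_sum_altCut]
  refine Finset.sum_congr rfl fun p hp => ?_
  obtain rfl := Finset.HasAntidiagonal.mem_antidiagonal.mp hp
  by_cases h : 0 < p.1 ∧ 0 < p.2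
  · rw [if_pos h, card_altCut h.1 h.2]
    simp only [h, and_true]
  · rw [if_neg h, if_neg (fun h' => h h'.2)]

theorem r_eq_card (n : ℕ) : r n = (altSep (2 * n + 1) 0).card := by
  rw [r, ← Set.ncard_coe_finset]
  congr 1
  ext π
  rw [mem_altAvoiding_iff, Finset.mem_coe, mem_altSep]


/-! ### Generating functions -/

theorem sum_antidiagonal_of_mod_two {M : Type*} [AddCommMonoid M] (f : ℕ × ℕ → M) (n a b : ℕ)
    (ha : a < 2) (hb : b < 2) (hf : ∀ p, p.1 % 2 ≠ a → f p = 0) :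
    ∑ p ∈ Finset.HasAntidiagonal.antidiagonal (2 * n + (a + b)), f p =
      ∑ q ∈ Finset.HasAntidiagonal.antidiagonal n, f (2 * q.1 + a, 2 * q.2 + b) := by
  rw [← Finset.sum_filter_of_ne (p := fun p => p.1 % 2 = a)
    (fun p _ hp => by_contra fun h => hp (hf p h))]
  refine Finset.sum_nbij' (fun p => (p.1 / 2, p.2 / 2)) (fun q => (2 * q.1 + a, 2 * q.2 + b))
    ?_ ?_ ?_ ?_ ?_
  · intro p hp
    simp only [Finset.mem_filter, Finset.HasAntidiagonal.mem_antidiagonal] at hp ⊢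
    omega
  · intro q hq
    simp only [Finset.mem_filter, Finset.HasAntidiagonal.mem_antidiagonal] at hq ⊢
    omega
  · intro p hp
    simp only [Finset.mem_filter, Finset.HasAntidiagonal.mem_antidiagonal] at hp
    ext <;> simp <;> omega
  · intro q _
    ext <;> simp <;> omega
  · intro p hp
    simp only [Finset.mem_filter, Finset.HasAntidiagonal.mem_antidiagonal] at hp
    congr 1
    ext <;> simp <;> omega

open PowerSeries

/-- The generating function of the odd-length direct sums with parity offset `e`. -/
noncomputable def oddDecSeries (e : ℕ) : PowerSeries ℚ :=
  mk fun n => ((altDec (2 * n + 1) e).card : ℚ)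

/-- The generating function of the even-length direct sums with parity offset `e`. -/
noncomputable def evenDecSeries (e : ℕ) : PowerSeries ℚ :=
  mk fun n => ((altDec (2 * n) e).card : ℚ)

/-- The generating function of the alternating separable permutations of positive even length. -/
noncomputable def evenSeries : PowerSeries ℚ :=
  mk fun n => if n = 0 then 0 else ((altSep (2 * n) 0).card : ℚ)

theorem card_altSep_eq_card_altDec_add {n : ℕ} (hn : 2 ≤ n) :
    (altSep n 0).card = (altDec n 0).card + (altDec n 1).card := by
  rw [← card_altIndec_add_card_altDec, card_altIndec hn, add_comm]

theorem coeff_R_add_one (n : ℕ) : coeff n (R + 1) = ((altSep (2 * n + 1) 0).card : ℚ) := by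
  rw [map_add, R, coeff_mk, coeff_one]
  rcases eq_or_ne n 0 with rfl | hn
  · simp [card_altSep_one]
  · simp [hn, r_eq_card]

theorem coeff_one_add_oddDecSeries (n : ℕ) :
    coeff n (1 + oddDecSeries 1) = ((altIndec (2 * n + 1) 0).card : ℚ) := by
  rw [map_add, oddDecSeries, coeff_mk, coeff_one]
  rcases eq_or_ne n 0 with rfl | hn
  · simp [card_altIndec_one, altDec_of_lt_two]
  · rw [if_neg hn, zero_add, card_altIndec (by omega)]

/-- The case n = 0 is separate because the empty permutation is vacuously indecomposable. -/
theorem coeff_evenDecSeries_zero (n : ℕ) :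
    coeff n (evenDecSeries 0) = if n = 0 then 0 else ((altIndec (2 * n) 1).card : ℚ) := by
  rw [evenDecSeries, coeff_mk]
  split_ifs with hn
  · subst hn; simp [altDec_of_lt_two]
  · rw [card_altIndec (by omega), altDec_add_two]

theorem R_add_one_eq : R + 1 = 1 + oddDecSeries 0 + oddDecSeries 1 := by
  ext n
  rw [coeff_R_add_one, map_add, map_add, coeff_one, oddDecSeries, oddDecSeries, coeff_mk, coeff_mk]
  rcases eq_or_ne n 0 with rfl | hn
  · simp [card_altSep_one, altDec_of_lt_two]
  · rw [if_neg hn, zero_add, card_altSep_eq_card_altDec_add (by omega), Nat.cast_add]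

theorem evenSeries_eq : evenSeries = evenDecSeries 0 + evenDecSeries 1 := by
  ext n
  rw [map_add, evenSeries, evenDecSeries, evenDecSeries, coeff_mk, coeff_mk, coeff_mk]
  split_ifs with hn
  · subst hn; simp [altDec_of_lt_two]
  · rw [card_altSep_eq_card_altDec_add (by omega), Nat.cast_add]

/-- The convolution `card_altDec`, with the parities of the lengths of both parts fixed. -/
theorem card_altDec_of_parity (n a b e : ℕ) (ha : a < 2) (hb : b < 2) (he : Odd (a + e)) :
    ((altDec (2 * n + (a + b)) e).card : ℚ) = ∑ q ∈ Finset.HasAntidiagonal.antidiagonal n,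
      (if 2 * q.1 + a = 0 then 0 else ((altIndec (2 * q.1 + a) e).card : ℚ)) *
      (if 2 * q.2 + b = 0 then 0 else ((altSep (2 * q.2 + b) 0).card : ℚ)) := by
  rw [card_altDec, sum_antidiagonal_of_mod_two _ n a b ha hb, Nat.cast_sum]
  · refine Finset.sum_congr rfl fun q _ => ?_
    have : Odd (2 * q.1 + a + e) := by
      rw [Nat.odd_iff] at he ⊢; omega
    simp only [this, true_and, Nat.pos_iff_ne_zero]
    split_ifs <;> simp_all
  · intro p hp
    refine if_neg fun h => hp ?_
    have := h.1
    rw [Nat.odd_iff] at he this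
    omega

theorem oddDecSeries_zero_eq : oddDecSeries 0 = (1 + oddDecSeries 1) * evenSeries := by
  ext n
  rw [coeff_mul, oddDecSeries, coeff_mk,
    card_altDec_of_parity n 1 0 0 (by omega) (by omega) (by simp)]
  refine Finset.sum_congr rfl fun q _ => ?_
  rw [coeff_one_add_oddDecSeries, evenSeries, coeff_mk]
  simp

theorem oddDecSeries_one_eq : oddDecSeries 1 = evenDecSeries 0 * (R + 1) := by
  ext n
  rw [coeff_mul, oddDecSeries, coeff_mk, show 2 * n + 1 = 2 * n + (0 + 1) by ring,
    card_altDec_of_parity n 0 1 1 (by omega) (by omega) (by simp)]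
  refine Finset.sum_congr rfl fun q _ => ?_
  rw [coeff_evenDecSeries_zero, coeff_R_add_one]
  simp

theorem evenDecSeries_one_eq : evenDecSeries 1 = evenDecSeries 0 * evenSeries := by
  ext n
  rw [coeff_mul]
  nth_rewrite 1 [evenDecSeries]
  rw [coeff_mk, show 2 * n = 2 * n + (0 + 0) by ring,
    card_altDec_of_parity n 0 0 1 (by omega) (by omega) (by simp)]
  refine Finset.sum_congr rfl fun q _ => ?_
  rw [coeff_evenDecSeries_zero, evenSeries, coeff_mk]
  simp

/-- Both summands have odd length, and (2i + 1) + (2j + 1) = 2(i + j + 1) accounts for the factor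
`X`. -/
theorem evenDecSeries_zero_eq : evenDecSeries 0 = X * ((1 + oddDecSeries 1) * (R + 1)) := by
  ext n
  rw [evenDecSeries, coeff_mk]
  rcases n with _ | n
  · simp [altDec_of_lt_two]
  · rw [coeff_succ_X_mul, coeff_mul, show 2 * (n + 1) = 2 * n + (1 + 1) by ring,
      card_altDec_of_parity n 1 1 0 (by omega) (by omega) (by simp)]
    refine Finset.sum_congr rfl fun q _ => ?_
    rw [coeff_one_add_oddDecSeries, coeff_R_add_one]
    simp

theorem R_eq : R = X * (R + 1) ^ 2 + X * (R + 1) ^ 3 := by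
  have h1 := R_add_one_eq
  have h2 := evenSeries_eq
  have h3 := oddDecSeries_zero_eq
  have h4 := oddDecSeries_one_eq
  have h5 := evenDecSeries_one_eq
  have h6 := evenDecSeries_zero_eq
  generalize hF : R + 1 = F at *
  generalize oddDecSeries 0 = a at *
  generalize oddDecSeries 1 = b at *
  generalize evenDecSeries 0 = c at *
  generalize evenDecSeries 1 = d at *
  generalize evenSeries = E at *
  -- F = (1 + b)(1 + E) and E = c(1 + E) give a = (1 + b)E = cF = b.
  have hab : a = b := by
    have hF' : F = (1 + b) * (1 + E) := by linear_combination h1 + h3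
    have hE : E = c * (1 + E) := by linear_combination h2 + h5
    linear_combination h3 - h4 + (1 + b) * hE - c * hF'
  subst hab
  have : R = F - 1 := by rw [← hF]; ring
  rw [this]
  -- Now F = 1 + 2a and a = cF = X(1 + a)F², where 2(1 + a) = 1 + F.
  linear_combination h1 + 2 * h4 + 2 * F * h6 - X * F ^ 2 * h1

end PermPattern

theorem mainTheorem8 :
    PermPattern.R = PowerSeries.X * (PermPattern.R + 1) ^ 2
        + PowerSeries.X * (PermPattern.R + 1) ^ 3 ∧
    PermPattern.r 0 = 1 ∧
    ∀ n : ℕ, 1 ≤ n →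
      (PermPattern.r n : ℚ) =
        (2 / (n : ℚ)) * ∑ i ∈ Finset.range n,
          (2 : ℚ) ^ i * ((2 * n).choose i : ℚ) * (n.choose (i + 1) : ℚ) := by
  refine ⟨PermPattern.R_eq, ?_, fun n hn => ?_⟩
  · rw [PermPattern.r_eq_card, PermPattern.card_altSep_one]
  · rw [← coeff_of_eq_X_mul_sq_add_X_mul_cube PermPattern.R_eq hn, PermPattern.R,
      PowerSeries.coeff_mk, if_neg (by omega)]
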